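/- **Theorem 8 (boundedness of the influence function).** *Setting.* Let $X\subset\mathbb R^n$, $Y\subset\mathbb R$, $Z=X\times Y$ (with a norm inherited from $\mathbb R^{n+1}$), and write $z=(x,y)$. Let $\mathcal H_k$ be a real reproducing kernel Hilbert space of functions on $X$ with continuous reproducing kernel $k$, $k_x=k(\cdot,x)$, and let $\mathcal F\subset\mathcal H_k$ be convex, with normal cone $\mathcal N_{\mathcal F}(f)=\{d:\langle d,g-f\rangle\le 0\ \forall g\in\mathcal F\}$ for $f\in\mathcal F$ and $\mathcal N_{\mathcal F}(f)=\emptyset$ for $f\notin\mathcal F$. Let $c:Z\times\mathbb R\to[0,\infty)$ be a loss such that $z\mapsto c(z,f(x))$ is measurable for each $f\in\mathcal F$, let $c_2',c_2''$ be its first and second derivatives in the second argument, let $\lambda>0$, and let $P$ be a probability measure on $Z$. Assume: * for $P$-almost every $z$, $c(z,\cdot)$ is convex and continuously differentiable on $\mathbb R$; * there is a continuous $\psi:Z\to[0,\infty)$ with $\psi\ge 1$ outside a compact set, $\mathbb E_P[\psi]<\infty$, and $c(z,f(x))\le\psi(z)$ for all $z\in Z$, $f\in\mathcal F$; * there is $L:Z\to[0,\infty)$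 with $\mathbb E_P[L]<\infty$ such that for $P$-almost every $z$, $|c(z,w_1)-c(z,w_2)|\le L(z)|w_1-w_2|$ for all $w_1,w_2\in Y$; * $c(z,\cdot)$ is twice differentiable on $\mathbb R$ for every $z\in Z$, and there are $C>0$, $p\ge1$ with $|c_2''(z_1,w_1)-c_2''(z_2,w_2)|\le C\max\{1,\|z_1\|,\|z_2\|\}^{p-1}(\|z_1-z_2\|+|w_1-w_2|)$ for all $z_1,z_2\in Z$, $w_1,w_2\in Y$; * for all $f\in\mathcal F$ and $h\in\mathcal H_k$, $c_2'(z,f(x))k_x$ and $c_2''(z,f(x))h(x)k_x$ are (Bochner) integrable with respect to $P$; * for every $\tilde z\in Z$ and $t\in[0,1)$, with $Q=(1-t)P+t\delta_{\tilde z}$, the generalized equation $0\in\mathbb E_Q[c_2'(z,f(x))k_x]+2\lambda f+\mathcal N_{\mathcal F}(f)$ has a unique solution, denoted $f_{Q,\lambda}$. Put $u^*=-\mathbb E_P[c_2'(z,f_{P,\lambda}(x))k_x]-2\lambda f_{P,\lambda}\in\mathcal N_{\mathcal F}(f_{P,\lambda})$ and assume that $\mathcal N_{\mathcal F}$ is proto-differentiable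 at $f_{P,\lambda}$ for $u^*$ with proto-derivative $(\mathcal N_{\mathcal F})'$, that is, the graphs of $d\mapsto(\mathcal N_{\mathcal F}(f_{P,\lambda}+\epsilon d)-u^*)/\epsilon$ have, as $\epsilon\downarrow0$, the same outer and inner (Painlevé–Kuratowski) limit in $\mathcal H_k\times\mathcal H_k$, and this limit is the graph of $(\mathcal N_{\mathcal F})'$. Suppose that the linearized generalized equation $$0\in\mathbb E_P[c_2''(z,f_{P,\lambda}(x))h(x)k_x]+2\lambda h+(\mathcal N_{\mathcal F})'(h)$$ has $h=0$ as its unique solution. The influence function at $\tilde z$ is $\mathrm{IF}(\tilde z)=\lim_{t\downarrow0}t^{-1}\big(f_{(1-t)P+t\delta_{\tilde z},\lambda}-f_{P,\lambda}\big)$ whenever this limit exists; in general, let $\mathrm{IF}(\tilde z)$ also denote the set $\limsup_{\epsilon\downarrow0,\,s\to1}\epsilon^{-1}\big(f_{(1-\epsilon s)P+\epsilon s\delta_{\tilde z},\lambda}-f_{P,\lambda}\big)$ of all limits, in norm, along sequences $\epsilon_j\downarrow0$, $s_j\to1$. *Conclusion.* (i) For every $\tilde z\in Z$ the influence function at $\tilde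 z$ is bounded: there is a constant $\kappa$, depending on $\tilde z$, such that $\|h\|_k\le\kappa$ for every $h$ in the set $\mathrm{IF}(\tilde z)$, and in particular for the limit $\mathrm{IF}(\tilde z)$ if it exists. (ii) If, in addition, $\Psi(f)=\mathbb E_P[c_2'(z,f(x))k_x]+2\lambda f+\mathcal N_{\mathcal F}(f)$ is strongly metrically subregular at $f_{P,\lambda}$ for $0$ with modulus $\kappa'>0$, i.e. there are neighborhoods $U$ of $f_{P,\lambda}$ and $U_0$ of $0$ with $\|f-f_{P,\lambda}\|_k\le\kappa'\,d(0,\Psi(f)\cap U_0)$ for all $f\in U$ (where $d(0,\emptyset)=\infty$), then there is $t_0\in(0,1)$ such that, in $[0,\infty]$, $$\sup_{\tilde z\in Z}\|\mathrm{IF}(\tilde z)\|_k\le\kappa'\sup_{\tilde z\in Z}\Upsilon(\tilde z),\qquad \Upsilon(\tilde z)=\sup_{t\in[0,t_0]}\big\|\mathbb E_P[c_2'(z,f_{(1-t)P+t\delta_{\tilde z},\lambda}(x))k_x]-c_2'(\tilde z,f_{(1-t)P+t\delta_{\tilde z},\lambda}(\tilde x))k_{\tilde x}\big\|_k,$$ where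 the left-hand supremum is over those $\tilde z$ at which the limit $\mathrm{IF}(\tilde z)$ exists, and the same bound holds for the supremum of $\|h\|_k$ over all $\tilde z\in Z$ and all $h$ in the set $\mathrm{IF}(\tilde z)$. -/

import Mathlib

open MeasureTheory Filter Topology Set

noncomputable section

namespace KernelIF

/-! ### Set-valued mappings: limits of sets, proto-derivatives, normal cones -/

section SetValued

variable {E : Type*} [NormedAddCommGroup E] [InnerProductSpace ℝ E]

/-- The outer limit of a family of sets `A ε` as `ε ↓ 0`. -/
def outerLimit {T : Type*} [TopologicalSpace T] (A : ℝ → Set T) : Set T :=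
  {a | ∃ (ε : ℕ → ℝ) (s : ℕ → T), Tendsto ε atTop (𝓝[>] 0) ∧
    (∀ᶠ j in atTop, s j ∈ A (ε j)) ∧ Tendsto s atTop (𝓝 a)}

/-- The inner limit of a family of sets `A ε` as `ε ↓ 0`. -/
def innerLimit {T : Type*} [TopologicalSpace T] (A : ℝ → Set T) : Set T :=
  {a | ∀ ε : ℕ → ℝ, Tendsto ε atTop (𝓝[>] 0) → ∃ s : ℕ → T,
    (∀ᶠ j in atTop, s j ∈ A (ε j)) ∧ Tendsto s atTop (𝓝 a)}

/-- The graph of a set-valued mapping. -/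
def gph (Γ : E → Set E) : Set (E × E) := {p | p.2 ∈ Γ p.1}

/-- The difference quotient mapping `d ↦ (Γ (f + ε d) - u) / ε`. -/
def diffQuot (Γ : E → Set E) (f u : E) (ε : ℝ) : E → Set E :=
  fun d => (fun v => ε⁻¹ • (v - u)) '' Γ (f + ε • d)

/-- `Γ` is proto-differentiable at `f` for `u ∈ Γ f`, and `D` is its proto-derivative: the
difference quotient mappings graph-converge to `D`. -/
def HasProtoDerivAt (Γ : E → Set E) (f u : E) (D : E → Set E) : Prop :=
  u ∈ Γ f ∧ outerLimit (fun ε => gph (diffQuot Γ f u ε)) = gph D ∧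
    innerLimit (fun ε => gph (diffQuot Γ f u ε)) = gph D

/-- The normal cone to a convex set `F` at `f`; it is empty when `f ∉ F`. -/
def normalCone (F : Set E) (f : E) : Set E :=
  {d | f ∈ F ∧ ∀ g ∈ F, inner ℝ d (g - f) ≤ 0}

/-- The set-valued mapping `Ψ` is strongly metrically subregular at `f₀` for `0` with modulus `κ`.
The distance to the empty set is `∞`. -/
def StronglyMetricallySubregular (Ψ : E → Set E) (f₀ : E) (κ : ℝ) : Prop :=
  0 < κ ∧ (0 : E) ∈ Ψ f₀ ∧ ∃ U ∈ 𝓝 f₀, ∃ U₀ ∈ 𝓝 (0 : E), ∀ f ∈ U,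
    ‖f - f₀‖ₑ ≤ ENNReal.ofReal κ * Metric.infEDist (0 : E) (Ψ f ∩ U₀)

end SetValued

/-! ### Data, loss and kernel

The data space is `Z = X × Y` with `X ⊆ ℝⁿ` and `Y ⊆ ℝ`, and `c : Z × ℝ → ℝ` is the loss. -/

section Learning

variable {n : ℕ} {X : Set (EuclideanSpace ℝ (Fin n))} {Y : Set ℝ}

/-- `c'₂(z, w)`. -/
def loss' (c : X × Y → ℝ → ℝ) (z : X × Y) (w : ℝ) : ℝ := deriv (c z) w

/-- `c''₂(z, w)`. -/
def loss'' (c : X × Y → ℝ → ℝ) (z : X × Y) (w : ℝ) : ℝ := deriv (deriv (c z)) w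

/-- The norm of a data point `z = (x, y)`. -/
def dataNorm (z : X × Y) : ℝ := max ‖(z.1 : EuclideanSpace ℝ (Fin n))‖ |(z.2 : ℝ)|

/-- `L_p(z₁, z₂) = max {1, ‖z₁‖, ‖z₂‖} ^ (p - 1)`. -/
def growth (p : ℝ) (z₁ z₂ : X × Y) : ℝ :=
  (max 1 (max (dataNorm z₁) (dataNorm z₂))) ^ (p - 1)

/-- A gauge function: continuous, nonnegative, and at least `1` outside some compact set. -/
def IsGauge (ψ : X × Y → ℝ) : Prop :=
  Continuous ψ ∧ (∀ z, 0 ≤ ψ z) ∧ ∃ K : Set (X × Y), IsCompact K ∧ ∀ z ∉ K, 1 ≤ ψ z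

/-- The loss is convex in its second argument for almost every `z`. -/
def LossConvex (c : X × Y → ℝ → ℝ) (P : Measure (X × Y)) : Prop :=
  ∀ᵐ z ∂P, ConvexOn ℝ univ (c z)

/-- Lipschitz continuity in the second argument with modulus `L z`. -/
def LossLipschitz (c : X × Y → ℝ → ℝ) (P : Measure (X × Y)) (L : X × Y → ℝ) : Prop :=
  (∀ z, 0 ≤ L z) ∧
    ∀ᵐ z ∂P, ∀ w₁ ∈ Y, ∀ w₂ ∈ Y, |c z w₁ - c z w₂| ≤ L z * |w₁ - w₂|

/-- The loss is continuously differentiable in its second argument for almost every `z`. -/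
def LossC1 (c : X × Y → ℝ → ℝ) (P : Measure (X × Y)) : Prop :=
  ∀ᵐ z ∂P, ContDiff ℝ 1 (c z)

/-- The second derivative in the second argument exists and is locally Lipschitz with
polynomial growth of the local moduli. -/
def LossSecondLipschitz (c : X × Y → ℝ → ℝ) : Prop :=
  (∀ z, Differentiable ℝ (c z) ∧ Differentiable ℝ (deriv (c z))) ∧
    ∃ C : ℝ, 0 < C ∧ ∃ p : ℝ, 1 ≤ p ∧ ∀ w₁ ∈ Y, ∀ w₂ ∈ Y, ∀ z₁ z₂ : X × Y,
      |loss'' c z₁ w₁ - loss'' c z₂ w₂| ≤ C * growth p z₁ z₂ * (dist z₁ z₂ + |w₁ - w₂|)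

/-- The mixture `(1 - t) P + t δ_z`. -/
def mixture (P : Measure (X × Y)) (z : X × Y) (t : ℝ) : Measure (X × Y) :=
  ENNReal.ofReal (1 - t) • P + ENNReal.ofReal t • Measure.dirac z

variable {H : Type*} [NormedAddCommGroup H] [InnerProductSpace ℝ H] [CompleteSpace H]
  [RKHS ℝ H X ℝ]

/-- The kernel section `k_x = k(·, x) ∈ H`. -/
def kSec (H : Type*) [NormedAddCommGroup H] [InnerProductSpace ℝ H] [CompleteSpace H]
    [RKHS ℝ H X ℝ] (x : X) : H := RKHS.kerFun H x (1 : ℝ)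

/-- The reproducing kernel of `H` is continuous on `X × X` (it is automatically symmetric and
positive semidefinite), i.e. it is a Mercer kernel. -/
def MercerKernel (H : Type*) [NormedAddCommGroup H] [InnerProductSpace ℝ H] [CompleteSpace H]
    [RKHS ℝ H X ℝ] : Prop :=
  Continuous fun p : X × X => (kSec H p.2 : H) p.1

/-- `c(z, f(x)) ≤ ψ(z)` for all `z ∈ Z` and `f ∈ F`, with a gauge function `ψ`. -/
def LossGaugeBound (c : X × Y → ℝ → ℝ) (F : Set H) (ψ : X × Y → ℝ) : Prop :=
  IsGauge ψ ∧ ∀ z, ∀ f ∈ F, c z (f z.1) ≤ ψ z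

/-- `c'₂(z, f(x)) k_x`. -/
def gradAt (c : X × Y → ℝ → ℝ) (f : H) (z : X × Y) : H := loss' c z (f z.1) • kSec H z.1

/-- `c''₂(z, f(x)) T_x h`, where `T_x h = h(x) k_x`. -/
def hessAt (c : X × Y → ℝ → ℝ) (f h : H) (z : X × Y) : H :=
  loss'' c z (f z.1) • (h z.1 • kSec H z.1)

/-- The moment conditions: for every `f ∈ F` and `h ∈ H`, the expectations of
`|c'₂(z, f(x))| ‖k_x‖` and of `|c''₂(z, f(x))| ‖T_x h‖` are finite. -/
def DerivativeMoments (c : X × Y → ℝ → ℝ) (F : Set H) (P : Measure (X × Y)) : Prop :=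
  ∀ f ∈ F, Integrable (gradAt c f) P ∧ ∀ h : H, Integrable (hessAt c f h) P

/-- The stationarity mapping `f ↦ E_Q[c'₂(z, f(x)) k_x] + 2 lam f + N_F(f)`. -/
def statMap (c : X × Y → ℝ → ℝ) (lam : ℝ) (F : Set H) (Q : Measure (X × Y)) (f : H) : Set H :=
  (fun d => (∫ z, gradAt c f z ∂Q) + (2 * lam) • f + d) '' normalCone F f

/-- `f_{Q,lam}`: the solution of `0 ∈ E_Q[c'₂(z, f(x)) k_x] + 2 lam f + N_F(f)`. -/
def statSol (c : X × Y → ℝ → ℝ) (lam : ℝ) (F : Set H) (Q : Measure (X × Y)) : H :=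
  Classical.epsilon fun f : H => (0 : H) ∈ statMap c lam F Q f

/-- `f_{(1 - t) P + t δ_z, lam}`. -/
def pertSol (c : X × Y → ℝ → ℝ) (lam : ℝ) (F : Set H) (P : Measure (X × Y)) (z : X × Y)
    (t : ℝ) : H :=
  statSol c lam F (mixture P z t)

/-- The influence function at `z` is well-defined and equal to `v`. -/
def HasInfluence (c : X × Y → ℝ → ℝ) (lam : ℝ) (F : Set H) (P : Measure (X × Y)) (z : X × Y)
    (v : H) : Prop :=
  Tendsto (fun t : ℝ => t⁻¹ • (pertSol c lam F P z t - statSol c lam F P)) (𝓝[>] 0) (𝓝 v)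

/-- The set-valued influence function
`limsup_{ε ↓ 0, s → 1} (f_{(1 - ε s) P + ε s δ_z, lam} - f_{P,lam}) / ε`. -/
def influenceSet (c : X × Y → ℝ → ℝ) (lam : ℝ) (F : Set H) (P : Measure (X × Y)) (z : X × Y) :
    Set H :=
  {h | ∃ ε s : ℕ → ℝ, Tendsto ε atTop (𝓝[>] 0) ∧ Tendsto s atTop (𝓝 1) ∧
    Tendsto (fun j => (ε j)⁻¹ • (pertSol c lam F P z (ε j * s j) - statSol c lam F P))
      atTop (𝓝 h)}

/-- The gradient discrepancy `Υ(z)`, a supremum over `t ∈ [0, t₀]` that may be `∞`. -/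
def discrepancy (c : X × Y → ℝ → ℝ) (lam : ℝ) (F : Set H) (P : Measure (X × Y)) (t₀ : ℝ)
    (z : X × Y) : ENNReal :=
  ⨆ t ∈ Icc (0 : ℝ) t₀,
    ‖(∫ z', gradAt c (pertSol c lam F P z t) z' ∂P) - gradAt c (pertSol c lam F P z t) z‖ₑ

end Learning

end KernelIF

end

namespace KernelIF

/-! Write f_t for the solution at (1 - t) P + t δ_z. The expected gradient (convex loss) and the
normal cone are monotone, so the term 2 lam f makes the stationarity mapping strongly monotone.
Subtracting the inclusions for f_t and f_0 and pairing with f_t - f_0 bounds ‖f_t - f_0‖ by t / (2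
lam) times a gradient gap (`norm_sub_le_of_mem_statMap`); dividing by t and letting t tend to 0
gives (i). For (ii), f_t solves the unperturbed inclusion up to a residual t r_t
(`residual_mem_statMap`), and subregularity turns the residual into the displacement bound κ' t
‖r_t‖. Both limits go through `exists_tendsto_of_mem_influenceSet`. -/

/-- The normal cone is a monotone operator. -/
theorem inner_sub_normalCone_nonneg {E : Type*} [NormedAddCommGroup E]
    [InnerProductSpace ℝ E] {F : Set E} {f g d e : E} (hd : d ∈ normalCone F f)
    (he : e ∈ normalCone F g) : 0 ≤ inner ℝ (d - e) (f - g) := by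
  have h₁ := hd.2 g he.1
  have h₂ := he.2 f hd.1
  rw [← neg_sub f g, inner_neg_right] at h₁
  rw [inner_sub_left]
  linarith

section Influence

variable {n : ℕ} {X : Set (EuclideanSpace ℝ (Fin n))} {Y : Set ℝ}
  {H : Type*} [NormedAddCommGroup H] [InnerProductSpace ℝ H] [CompleteSpace H] [RKHS ℝ H X ℝ]
  {c : X × Y → ℝ → ℝ} {lam : ℝ} {F : Set H} {P : Measure (X × Y)}

/-! ### The gradient map: monotonicity and continuity. -/

theorem inner_gradAt (f g : H) (z : X × Y) :
    inner ℝ (gradAt c f z) g = loss' c z (f z.1) * g z.1 := by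
  simp [gradAt, kSec, real_inner_smul_left]

/-- The expected gradient is a monotone operator, by convexity of the loss. -/
theorem inner_integral_gradAt_sub_nonneg (hconv : LossConvex c P) (hC1 : LossC1 c P) {f g : H}
    (hf : Integrable (gradAt c f) P) (hg : Integrable (gradAt c g) P) :
    0 ≤ inner ℝ ((∫ z, gradAt c f z ∂P) - ∫ z, gradAt c g z ∂P) (f - g) := by
  rw [← integral_sub hf hg, real_inner_comm,
    ← integral_inner (f := fun z => gradAt c f z - gradAt c g z) (hf.sub hg)]
  refine integral_nonneg_of_ae ?_
  filter_upwards [hconv, hC1] with z hz hd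
  have hmono : Monotone (deriv (c z)) :=
    monotoneOn_univ.1 (hz.monotoneOn_deriv fun x _ => hd.differentiable one_ne_zero x)
  rw [Pi.zero_apply, real_inner_comm, inner_sub_left, inner_gradAt, inner_gradAt,
    RKHS.coe_sub, Pi.sub_apply, ← sub_mul]
  simp only [loss']
  rcases le_total (f z.1) (g z.1) with h | h
  · exact mul_nonneg_of_nonpos_of_nonpos (sub_nonpos.2 (hmono h)) (sub_nonpos.2 h)
  · exact mul_nonneg (sub_nonneg.2 (hmono h)) (sub_nonneg.2 h)

/-- Point evaluations are continuous on `H`; this is what lets the gradient at the contaminating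
point pass to the limit f_t → f_0. -/
theorem continuous_gradAt (hdiff : ∀ z, Differentiable ℝ (deriv (c z))) (z : X × Y) :
    Continuous fun f : H => gradAt c f z :=
  ((hdiff z).continuous.comp (RKHS.continuous_eval z.1)).smul continuous_const

/-! ### The perturbed stationarity system. -/

theorem mixture_zero (P : Measure (X × Y)) (z : X × Y) : mixture P z 0 = P := by
  simp [mixture]

theorem integral_mixture {f : H} (hf : Integrable (gradAt c f) P) (z : X × Y) {t : ℝ}
    (ht : t ∈ Icc (0 : ℝ) 1) :
    ∫ z', gradAt c f z' ∂mixture P z t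
      = (1 - t) • (∫ z', gradAt c f z' ∂P) + t • gradAt c f z := by
  have hdirac : Integrable (gradAt c f) (Measure.dirac z) := integrable_dirac enorm_lt_top
  rw [mixture, integral_add_measure (hf.smul_measure ENNReal.ofReal_ne_top)
    (hdirac.smul_measure ENNReal.ofReal_ne_top), integral_smul_measure, integral_smul_measure,
    integral_dirac, ENNReal.toReal_ofReal (sub_nonneg.2 ht.2), ENNReal.toReal_ofReal ht.1]

/-- `statSol` is an `epsilon` choice, hence a genuine solution only once existence is known. -/
theorem zero_mem_statMap_statSol {Q : Measure (X × Y)}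
    (h : ∃ f : H, (0 : H) ∈ statMap c lam F Q f) :
    (0 : H) ∈ statMap c lam F Q (statSol c lam F Q) :=
  Classical.epsilon_spec (p := fun f : H => (0 : H) ∈ statMap c lam F Q f) h

/-- The solution of the perturbed system solves the unperturbed one up to the residual
`t • (E_P[c'₂(z', f(x')) k_x'] - c'₂(z, f(x)) k_x)`. -/
theorem residual_mem_statMap (hmom : DerivativeMoments c F P) {z : X × Y} {t : ℝ}
    (ht : t ∈ Icc (0 : ℝ) 1) {f : H} (hf : (0 : H) ∈ statMap c lam F (mixture P z t) f) :
    t • ((∫ z', gradAt c f z' ∂P) - gradAt c f z) ∈ statMap c lam F P f := by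
  obtain ⟨d, hd, h⟩ := hf
  refine ⟨d, hd, ?_⟩
  simp only [integral_mixture (hmom f hd.1).1 z ht] at h
  rw [← sub_eq_zero, ← h]
  module

/-- Strong monotonicity bounds the displacement of the perturbed solution. -/
theorem norm_sub_le_of_mem_statMap (hlam : 0 < lam) (hconv : LossConvex c P) (hC1 : LossC1 c P)
    (hmom : DerivativeMoments c F P) {z : X × Y} {t : ℝ} (ht : t ∈ Icc (0 : ℝ) 1) {f f₀ : H}
    (hf : (0 : H) ∈ statMap c lam F (mixture P z t) f) (hf₀ : (0 : H) ∈ statMap c lam F P f₀) :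
    ‖f - f₀‖ ≤ t * ((2 * lam)⁻¹ * ‖(∫ z', gradAt c f₀ z' ∂P) - gradAt c f z‖) := by
  obtain ⟨d, hd, h⟩ := hf
  obtain ⟨e, he, h'⟩ := hf₀
  have hG := inner_integral_gradAt_sub_nonneg hconv hC1 (hmom f hd.1).1 (hmom f₀ he.1).1
  have hN := inner_sub_normalCone_nonneg hd he
  simp only [integral_mixture (hmom f hd.1).1 z ht] at h h'
  set G := ∫ z', gradAt c f z' ∂P
  set G₀ := ∫ z', gradAt c f₀ z' ∂P
  -- The gap is taken with G₀, not G: the leftover G - G₀ then has weight 1 - t ≥ 0, and every term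
  -- on the right pairs nonnegatively with f - f₀.
  have key : t • (G₀ - gradAt c f z)
      = (1 - t) • (G - G₀) + (2 * lam) • (f - f₀) + (d - e) := by
    rw [← sub_eq_zero]
    calc _ = -((1 - t) • G + t • gradAt c f z + (2 * lam) • f + d)
          + (G₀ + (2 * lam) • f₀ + e) := by module
      _ = 0 := by rw [h, h', neg_zero, zero_add]
  have hin := congrArg (fun v => inner ℝ v (f - f₀)) key
  simp only [inner_add_left, real_inner_smul_left, real_inner_self_eq_norm_sq] at hin
  have hcs := real_inner_le_norm (G₀ - gradAt c f z) (f - f₀)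
  have hle : 2 * lam * ‖f - f₀‖ ^ 2 ≤ t * (‖G₀ - gradAt c f z‖ * ‖f - f₀‖) := by
    have := mul_nonneg (sub_nonneg.2 ht.2) hG
    have := mul_le_mul_of_nonneg_left hcs ht.1
    linarith
  rcases (norm_nonneg (f - f₀)).eq_or_lt with h0 | h0
  · rw [← h0]
    have := ht.1
    positivity
  · rw [mul_left_comm, inv_mul_eq_div, le_div_iff₀ (by positivity)]
    refine le_of_mul_le_mul_right ?_ h0
    linarith

/-! ### Passage to the limit along sequences. -/

theorem HasInfluence.mem_influenceSet {z : X × Y} {v : H} (hv : HasInfluence c lam F P z v) :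
    v ∈ influenceSet c lam F P z := by
  have hε : Tendsto (fun j : ℕ => ((j : ℝ) + 1)⁻¹) atTop (𝓝[>] 0) :=
    tendsto_inv_atTop_nhdsGT_zero.comp
      (tendsto_atTop_add_const_right _ 1 tendsto_natCast_atTop_atTop)
  refine ⟨_, fun _ => 1, hε, tendsto_const_nhds, ?_⟩
  simpa only [mul_one] using! hv.comp hε

/-- Along any sequence realizing an element `h` of the influence set, the perturbed solutions
converge, and a bound `t * b` on the displacements is inherited by `h` in the limit. -/
theorem exists_tendsto_of_mem_influenceSet {z : X × Y} {h : H}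
    (hh : h ∈ influenceSet c lam F P z) :
    ∃ t : ℕ → ℝ, Tendsto t atTop (𝓝[>] 0) ∧
      Tendsto (fun j => pertSol c lam F P z (t j)) atTop (𝓝 (statSol c lam F P)) ∧
      ∀ (b : ℕ → ℝ) (B : ℝ), Tendsto b atTop (𝓝 B) →
        (∀ᶠ j in atTop, ‖pertSol c lam F P z (t j) - statSol c lam F P‖ ≤ t j * b j) →
        ‖h‖ ≤ B := by
  obtain ⟨ε, s, hε, hs, hlim⟩ := hh
  have hε0 : Tendsto ε atTop (𝓝 0) := hε.mono_right nhdsWithin_le_nhds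
  have hεpos : ∀ᶠ j in atTop, 0 < ε j := hε self_mem_nhdsWithin
  refine ⟨fun j => ε j * s j, tendsto_nhdsWithin_iff.2 ⟨by simpa using hε0.mul hs, ?_⟩, ?_, ?_⟩
  · filter_upwards [hεpos, hs.eventually (lt_mem_nhds one_pos)] with j h₁ h₂
    exact mul_pos h₁ h₂
  -- The displacement is ε j → 0 times a convergent quotient.
  · rw [tendsto_iff_norm_sub_tendsto_zero, ← tendsto_zero_iff_norm_tendsto_zero]
    have := hε0.smul hlim
    rw [zero_smul] at this
    refine this.congr' ?_
    filter_upwards [hεpos] with j hj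
    rw [smul_inv_smul₀ hj.ne']
  · intro b B hb hle
    -- Dividing the bound t j * b j by ε j leaves the factor s j → 1.
    have hsb : Tendsto (fun j => s j * b j) atTop (𝓝 B) := by simpa using hs.mul hb
    refine le_of_tendsto_of_tendsto hlim.norm hsb ?_
    filter_upwards [hεpos, hle] with j hj hj'
    rw [norm_smul, norm_inv, Real.norm_of_nonneg hj.le, inv_mul_le_iff₀ hj, ← mul_assoc]
    exact hj'

/-- Elements of the influence set at `z` are bounded by
`‖E_P[c'₂(z', f(x')) k_x'] - c'₂(z, f(x)) k_x‖ / (2 lam)` with `f = f_{P,lam}`. -/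
theorem norm_le_of_mem_influenceSet (hlam : 0 < lam) (hconv : LossConvex c P) (hC1 : LossC1 c P)
    (hdiff : ∀ z, Differentiable ℝ (deriv (c z))) (hmom : DerivativeMoments c F P)
    {z : X × Y} (hsol : ∀ t ∈ Ico (0 : ℝ) 1, ∃ f : H, (0 : H) ∈ statMap c lam F (mixture P z t) f)
    {h : H} (hh : h ∈ influenceSet c lam F P z) :
    ‖h‖ ≤ (2 * lam)⁻¹ * ‖(∫ z', gradAt c (statSol c lam F P) z' ∂P)
      - gradAt c (statSol c lam F P) z‖ := by
  obtain ⟨t, ht, hf, hbound⟩ := exists_tendsto_of_mem_influenceSet hh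
  have hzero : (0 : H) ∈ statMap c lam F P (statSol c lam F P) := by
    have := hsol 0 (left_mem_Ico.2 one_pos)
    rw [mixture_zero] at this
    exact zero_mem_statMap_statSol this
  refine hbound _ _ ((tendsto_const_nhds.sub
    (((continuous_gradAt hdiff z).tendsto _).comp hf)).norm.const_mul _) ?_
  filter_upwards [ht (Ioo_mem_nhdsGT one_pos)] with j hj
  exact norm_sub_le_of_mem_statMap hlam hconv hC1 hmom (Ioo_subset_Icc_self hj)
    (zero_mem_statMap_statSol (hsol _ (Ioo_subset_Ico_self hj))) hzero

/-- Under strong metric subregularity, elements of the influence set are bounded by the modulus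
times any uniform bound on the gradient discrepancy. -/
theorem enorm_le_of_mem_influenceSet_of_subregular (hmom : DerivativeMoments c F P) {z : X × Y}
    (hsol : ∀ t ∈ Ico (0 : ℝ) 1, ∃ f : H, (0 : H) ∈ statMap c lam F (mixture P z t) f)
    {κ : ℝ} (hκ : StronglyMetricallySubregular (statMap c lam F P) (statSol c lam F P) κ)
    {t₀ : ℝ} (ht₀ : t₀ ∈ Ioo (0 : ℝ) 1) {h : H} (hh : h ∈ influenceSet c lam F P z) :
    ‖h‖ₑ ≤ ENNReal.ofReal κ * discrepancy c lam F P t₀ z := by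
  obtain ⟨hκ0, -, U, hU, U₀, hU₀, hsub⟩ := hκ
  -- As κ > 0, an infinite discrepancy makes the right side ∞ (0 * ∞ would be 0).
  rcases eq_or_ne (discrepancy c lam F P t₀ z) ⊤ with htop | htop
  · rw [htop, ENNReal.mul_top (ENNReal.ofReal_pos.2 hκ0).ne']
    exact le_top
  set M := discrepancy c lam F P t₀ z with hM
  obtain ⟨t, ht, hf, hbound⟩ := exists_tendsto_of_mem_influenceSet hh
  have htIoo : ∀ᶠ j in atTop, t j ∈ Ioo 0 t₀ := ht (Ioo_mem_nhdsGT ht₀.1)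
  have ht0 : Tendsto t atTop (𝓝 0) := ht.mono_right nhdsWithin_le_nhds
  let r : ℕ → H := fun j => (∫ z', gradAt c (pertSol c lam F P z (t j)) z' ∂P)
    - gradAt c (pertSol c lam F P z (t j)) z
  have hr : ∀ᶠ j in atTop, ‖r j‖ ≤ M.toReal := by
    filter_upwards [htIoo] with j hj
    rw [← toReal_enorm]
    refine ENNReal.toReal_mono htop ?_
    rw [hM, discrepancy]
    exact le_iSup₂_of_le (t j) (Ioo_subset_Icc_self hj) le_rfl
  -- Finiteness of M forces the residuals to 0, hence eventually into U₀, where subregularity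
  -- applies.
  have hres : Tendsto (fun j => t j • r j) atTop (𝓝 0) := by
    refine squeeze_zero_norm' (a := fun j => t j * M.toReal) ?_ (by simpa using ht0.mul_const _)
    filter_upwards [hr, htIoo] with j hj hj'
    rw [norm_smul, Real.norm_of_nonneg hj'.1.le]
    exact mul_le_mul_of_nonneg_left hj hj'.1.le
  have hle : ‖h‖ ≤ κ * M.toReal := by
    refine hbound _ _ tendsto_const_nhds ?_
    filter_upwards [htIoo, hr, hres hU₀, hf hU] with j hj hrj hjU₀ hjU
    have hj1 : t j ∈ Ico (0 : ℝ) 1 := ⟨hj.1.le, hj.2.trans ht₀.2⟩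
    have hmem := residual_mem_statMap hmom (Ico_subset_Icc_self hj1)
      (zero_mem_statMap_statSol (hsol _ hj1))
    have hinf := Metric.infEDist_le_edist_of_mem (x := (0 : H)) (mem_inter hmem hjU₀)
    have hdist := (hsub _ hjU).trans (mul_le_mul_right hinf _)
    rw [edist_dist, dist_zero_left, ← ofReal_norm, ← ENNReal.ofReal_mul hκ0.le,
      ENNReal.ofReal_le_ofReal_iff (by positivity), norm_smul,
      Real.norm_of_nonneg hj.1.le] at hdist
    refine hdist.trans ?_
    rw [mul_left_comm]
    exact mul_le_mul_of_nonneg_left (mul_le_mul_of_nonneg_left hrj hκ0.le) hj.1.le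
  rw [← ENNReal.ofReal_toReal htop, ← ENNReal.ofReal_mul hκ0.le, ← ofReal_norm]
  exact ENNReal.ofReal_le_ofReal hle

end Influence

end KernelIF

theorem theorem8 {n : ℕ} {X : Set (EuclideanSpace ℝ (Fin n))} {Y : Set ℝ}
    {H : Type*} [NormedAddCommGroup H] [InnerProductSpace ℝ H] [CompleteSpace H] [RKHS ℝ H X ℝ]
    (hk : KernelIF.MercerKernel (X := X) H)
    (F : Set H) (hF : Convex ℝ F)
    (c : X × Y → ℝ → ℝ) (hc : ∀ z w, 0 ≤ c z w)
    (hcm : ∀ f ∈ F, Measurable fun z : X × Y => c z (f z.1))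
    (lam : ℝ) (hlam : 0 < lam)
    (P : Measure (X × Y)) [IsProbabilityMeasure P]
    (ψ L : X × Y → ℝ)
    (hC1 : KernelIF.LossConvex c P)
    (hC2 : KernelIF.LossGaugeBound c F ψ)
    (hC3 : KernelIF.LossLipschitz c P L)
    (hC4 : KernelIF.LossC1 c P)
    (hC5 : KernelIF.LossSecondLipschitz c)
    (hψ : Integrable ψ P) (hL : Integrable L P)
    (hmom : KernelIF.DerivativeMoments c F P)
    -- the perturbed stationarity systems are uniquely solvable
    (hsol : ∀ z : X × Y, ∀ t ∈ Ico (0 : ℝ) 1,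
      ∃! f : H, (0 : H) ∈ KernelIF.statMap c lam F (KernelIF.mixture P z t) f)
    (D : H → Set H)
    (hD : KernelIF.HasProtoDerivAt (KernelIF.normalCone F) (KernelIF.statSol c lam F P)
      (-(∫ z, KernelIF.gradAt c (KernelIF.statSol c lam F P) z ∂P)
        - (2 * lam) • KernelIF.statSol c lam F P) D)
    -- the linearized generalized equation has the unique solution `0`
    (hlin : ∀ h : H,
      (∃ g ∈ D h, (∫ z, KernelIF.hessAt c (KernelIF.statSol c lam F P) h z ∂P)
        + (2 * lam) • h + g = 0) ↔ h = 0) :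
    (∀ z : X × Y, ∃ κ : ℝ,
      (∀ v : H, KernelIF.HasInfluence c lam F P z v → ‖v‖ ≤ κ) ∧
      ∀ h ∈ KernelIF.influenceSet c lam F P z, ‖h‖ ≤ κ) ∧
    ∀ κ' : ℝ, KernelIF.StronglyMetricallySubregular (KernelIF.statMap c lam F P)
        (KernelIF.statSol c lam F P) κ' →
      ∃ t₀ ∈ Ioo (0 : ℝ) 1,
        (⨆ z : X × Y, ⨆ v : H, ⨆ _ : KernelIF.HasInfluence c lam F P z v, ‖v‖ₑ)
          ≤ ENNReal.ofReal κ' * ⨆ z : X × Y, KernelIF.discrepancy c lam F P t₀ z ∧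
        (⨆ z : X × Y, ⨆ h ∈ KernelIF.influenceSet c lam F P z, ‖h‖ₑ)
          ≤ ENNReal.ofReal κ' * ⨆ z : X × Y, KernelIF.discrepancy c lam F P t₀ z := by
  have hex : ∀ z : X × Y, ∀ t ∈ Ico (0 : ℝ) 1,
      ∃ f : H, (0 : H) ∈ KernelIF.statMap c lam F (KernelIF.mixture P z t) f :=
    fun z t ht => (hsol z t ht).exists
  refine ⟨fun z => ?_, fun κ' hκ' => ?_⟩
  · have hle := fun {h : H} => KernelIF.norm_le_of_mem_influenceSet (h := h) hlam hC1 hC4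
      (fun z => (hC5.1 z).2) hmom (hex z)
    exact ⟨_, fun v hv => hle hv.mem_influenceSet, fun h hh => hle hh⟩
  -- Any t₀ in (0, 1) would do: the limits only see t near 0.
  · have ht₀ : (1 / 2 : ℝ) ∈ Ioo (0 : ℝ) 1 := by norm_num
    have hle : ∀ (z : X × Y), ∀ h ∈ KernelIF.influenceSet c lam F P z, ‖h‖ₑ
        ≤ ENNReal.ofReal κ' * ⨆ z : X × Y, KernelIF.discrepancy c lam F P (1 / 2) z :=
      fun z h hh => (KernelIF.enorm_le_of_mem_influenceSet_of_subregular hmom (hex z) hκ' ht₀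
        hh).trans (mul_le_mul_right (le_iSup _ z) _)
    exact ⟨1 / 2, ht₀, iSup_le fun z => iSup₂_le fun v hv => hle z v hv.mem_influenceSet,
      iSup_le fun z => iSup₂_le fun h hh => hle z h hh⟩
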